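/- Let $(X,Y)$ be a bivariate normal random vector with zero mean vector, variances $\sigma_X^2,\sigma_Y^2$ (where $\sigma_X,\sigma_Y>0$) and correlation coefficient $\rho$ with $0\le\rho<1$. Put $s=\sigma_X\sigma_Y$ and $Z=XY$. Let $K_0(x)=\int_0^\infty e^{-x\cosh t}\,\mathrm{d}t$ $(x>0)$ denote the modified Bessel function of the second kind of order zero. Then $Z$ has probability density function $$f_Z(x)=\frac{1}{\pi s\sqrt{1-\rho^2}}\exp\left(\frac{\rho x}{s(1-\rho^2)}\right)K_0\left(\frac{|x|}{s(1-\rho^2)}\right),\qquad x\neq0,$$ and, for every $x>0$, $$\mathbb{P}(Z>x)<\frac1\pi\sqrt{\frac{1+\rho}{1-\rho}}\exp\left(\frac{\rho x}{s(1-\rho^2)}\right)K_0\left(\frac{x}{s(1-\rho^2)}\right)=s(1+\rho)f_Z(x).$$ Moreover, this upper bound is tight as $x\to\infty$: $\mathbb{P}(Z>x)\sim s(1+\rho)f_Z(x)$, that is, the ratio of the two sides tends to $1$ as $x\to\infty$. -/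

import Mathlib

open MeasureTheory ProbabilityTheory Filter Asymptotics

/-- The modified Bessel function of the second kind,
`K_ν(x) = ∫_0^∞ exp (-x cosh t) cosh (ν t) dt`, for real `ν` and `x > 0`. -/
noncomputable def besselK (ν x : ℝ) : ℝ :=
  ∫ t in Set.Ioi (0 : ℝ), Real.exp (-x * Real.cosh t) * Real.cosh (ν * t)

/-- The function `f_Z`: the density of the product of two zero mean normal random variables with
correlation `ρ` and product of standard deviations `s`. (Its value at the single point `x = 0`,
where the true density is infinite, is irrelevant.) -/
noncomputable def productNormalPDF (s ρ x : ℝ) : ℝ :=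
  1 / (Real.pi * s * Real.sqrt (1 - ρ ^ 2)) * Real.exp (ρ * x / (s * (1 - ρ ^ 2))) *
    besselK 0 (|x| / (s * (1 - ρ ^ 2)))

/-- `(X, Y)` is a bivariate normal random vector with zero mean vector, standard deviations
`σX`, `σY` and correlation coefficient `ρ`. -/
structure IsCenteredBivariateNormal {Ω : Type*} [MeasurableSpace Ω] (X Y : Ω → ℝ) (P : Measure Ω)
    (σX σY ρ : ℝ) : Prop where
  hasGaussianLaw : HasGaussianLaw (fun ω ↦ (X ω, Y ω)) P
  mean_fst : ∫ ω, X ω ∂P = 0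
  mean_snd : ∫ ω, Y ω ∂P = 0
  variance_fst : variance X P = σX ^ 2
  variance_snd : variance Y P = σY ^ 2
  covariance_eq : covariance X Y P = ρ * σX * σY

/-!
The density. With `c = ρ σY / σX`, the residual `W = Y - c X` is jointly Gaussian with `X` and
uncorrelated with it, hence independent of it (`IsCenteredBivariateNormal.map_residual`). Thus
`Z = X (W + c X)` has at `z ≠ 0` the density `∫ p_X(x) p_W(z / x - c x) / |x| dx`
(`map_mul_add_mul_prod_withDensity`). The exponent of the integrand is
`ρ a z - (x² / σX² + z² / (σY² x²)) / (2 (1 - ρ²))` with `a = 1 / (s (1 - ρ²))`, and the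
substitution `x² = (σX |z| / σY) exp u` turns it into `ρ a z - a |z| cosh u`, so that the integral
is a multiple of `K₀ (a |z|)` (`lintegral_gaussianPDF_mul_gaussianPDF`).

The tail. Inserting `K₀ (a y) = ∫ exp (-a y cosh t) dt` and integrating first in `y`, the integral
of `exp (ρ a y) K₀ (a y)` over `y > x` becomes
`exp (ρ a x) / a * ∫ exp (-a x cosh t) / (cosh t - ρ) dt` (`lintegral_Ioi_exp_mul_besselK`). Since
`cosh t > 1` for `t > 0`, the last integral is strictly less than `K₀ (a x) / (1 - ρ)`
(`besselTail_lt`), which is the upper bound.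

Tightness. By convexity `1 / (cosh t - ρ) ≥ 1 / (1 - ρ) - (cosh t - 1) / (1 - ρ)²`, and integrating
the derivative of `exp (-x cosh t) tanh (t / 2)` gives
`x ∫ exp (-x cosh t) (cosh t - 1) dt = ∫ exp (-x cosh t) / (1 + cosh t) dt ≤ K₀ x`. Hence the
quotient of the two sides is at least `1 - O(1 / x)` (`le_besselTail`).
-/

/-! ### The Bessel function `K₀` -/

lemma le_cosh_of_nonneg {t : ℝ} (ht : 0 ≤ t) : t ≤ Real.cosh t :=
  (Real.self_le_sinh_iff.2 ht).trans (Real.sinh_lt_cosh t).le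

lemma integrableOn_exp_neg_mul_cosh {x : ℝ} (hx : 0 < x) :
    IntegrableOn (fun t ↦ Real.exp (-x * Real.cosh t)) (Set.Ioi 0) := by
  refine (integrableOn_exp_mul_Ioi (neg_lt_zero.2 hx) 0).mono'
    (by fun_prop) ?_
  filter_upwards [ae_restrict_mem measurableSet_Ioi] with t ht
  rw [Real.norm_eq_abs, Real.abs_exp, Real.exp_le_exp]
  have := le_cosh_of_nonneg (le_of_lt ht)
  nlinarith

/-- A bounded continuous factor does not affect integrability. -/
lemma integrableOn_exp_neg_mul_cosh_mul {x b : ℝ} (hx : 0 < x) {h : ℝ → ℝ}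
    (hc : Continuous h) (hb : ∀ t, |h t| ≤ b) :
    IntegrableOn (fun t ↦ Real.exp (-x * Real.cosh t) * h t) (Set.Ioi 0) :=
  (integrableOn_exp_neg_mul_cosh hx).mul_bdd (c := b) hc.aestronglyMeasurable
    (Eventually.of_forall hb)

lemma besselK_zero_eq (x : ℝ) :
    besselK 0 x = ∫ t in Set.Ioi (0 : ℝ), Real.exp (-x * Real.cosh t) := by
  simp [besselK]

lemma ofReal_besselK_zero {x : ℝ} (hx : 0 < x) :
    ENNReal.ofReal (besselK 0 x) =
      ∫⁻ t in Set.Ioi (0 : ℝ), ENNReal.ofReal (Real.exp (-x * Real.cosh t)) := by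
  rw [besselK_zero_eq, ofReal_integral_eq_lintegral_ofReal (integrableOn_exp_neg_mul_cosh hx)
    (Eventually.of_forall fun t ↦ (Real.exp_pos _).le)]

lemma besselK_zero_pos {x : ℝ} (hx : 0 < x) : 0 < besselK 0 x := by
  rw [besselK_zero_eq, integral_pos_iff_support_of_nonneg (fun t ↦ (Real.exp_pos _).le)
    (integrableOn_exp_neg_mul_cosh hx)]
  have : Function.support (fun t ↦ Real.exp (-x * Real.cosh t)) = Set.univ :=
    Set.eq_univ_of_forall fun t ↦ (Real.exp_pos _).ne'
  rw [this]
  simp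

lemma integrableOn_exp_neg_mul_cosh_div {x : ℝ} (hx : 0 < x) :
    IntegrableOn (fun t ↦ Real.exp (-x * Real.cosh t) * (1 / (1 + Real.cosh t))) (Set.Ioi 0) := by
  refine integrableOn_exp_neg_mul_cosh_mul (b := 1) hx ?_ fun t ↦ ?_
  · exact continuous_const.div (by fun_prop) fun t ↦ (add_pos one_pos (Real.cosh_pos t)).ne'
  · have := Real.cosh_pos t
    rw [abs_of_pos (by positivity), div_le_one (by positivity)]
    linarith

lemma integrableOn_exp_neg_mul_cosh_mul_cosh_sub_one {x : ℝ} (hx : 0 < x) :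
    IntegrableOn (fun t ↦ Real.exp (-x * Real.cosh t) * (Real.cosh t - 1)) (Set.Ioi 0) := by
  -- half of the exponential absorbs the factor `cosh t - 1`
  refine ((integrableOn_exp_neg_mul_cosh (half_pos hx)).const_mul (2 / x)).mono'
    (by fun_prop) (Eventually.of_forall fun t ↦ ?_)
  have h1 := Real.one_le_cosh t
  rw [Real.norm_eq_abs, abs_of_nonneg (mul_nonneg (Real.exp_pos _).le (by linarith))]
  have h2 : Real.exp (-x * Real.cosh t) =
      Real.exp (-(x / 2) * Real.cosh t) * Real.exp (-(x / 2) * Real.cosh t) := by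
    rw [← Real.exp_add]; ring_nf
  have h3 : Real.exp (-(x / 2) * Real.cosh t) * (Real.cosh t - 1) ≤ 2 / x := by
    have h4 := Real.add_one_le_exp (x / 2 * Real.cosh t)
    rw [neg_mul, Real.exp_neg, inv_mul_le_iff₀ (Real.exp_pos _), ← mul_div_assoc,
      le_div_iff₀ hx]
    nlinarith
  rw [h2, mul_assoc, mul_comm (2 / x)]
  gcongr

/-- Integration over `(0, ∞)` of the derivative of `exp (-x cosh t) tanh (t / 2)`, which vanishes
at both ends; `tanh (t / 2)` is written as `sinh t / (1 + cosh t)`. -/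
lemma integral_exp_neg_mul_cosh_div {x : ℝ} (hx : 0 < x) :
    ∫ t in Set.Ioi (0 : ℝ), Real.exp (-x * Real.cosh t) * (1 / (1 + Real.cosh t)) =
      x * ∫ t in Set.Ioi (0 : ℝ), Real.exp (-x * Real.cosh t) * (Real.cosh t - 1) := by
  have hpos (t : ℝ) : 0 < 1 + Real.cosh t := add_pos one_pos (Real.cosh_pos t)
  have hint1 := integrableOn_exp_neg_mul_cosh_div hx
  have hint2 := (integrableOn_exp_neg_mul_cosh_mul_cosh_sub_one hx).const_mul x
  have hderiv (t : ℝ) : HasDerivAt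
      (fun t ↦ Real.exp (-x * Real.cosh t) * (Real.sinh t / (1 + Real.cosh t)))
      (Real.exp (-x * Real.cosh t) * (1 / (1 + Real.cosh t)) -
        x * (Real.exp (-x * Real.cosh t) * (Real.cosh t - 1))) t := by
    have hd := ((Real.hasDerivAt_cosh t).const_mul (-x)).exp.fun_mul
      ((Real.hasDerivAt_sinh t).fun_div ((Real.hasDerivAt_cosh t).const_add 1) (hpos t).ne')
    convert! hd using 1
    have h1 := hpos t
    have h2 := Real.cosh_sq t
    field_simp
    linear_combination (-1 - x * (1 + Real.cosh t)) * h2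
  have htend : Tendsto (fun t ↦ Real.exp (-x * Real.cosh t) * (Real.sinh t / (1 + Real.cosh t)))
      atTop (nhds 0) := by
    have h0 : Tendsto (fun t ↦ Real.exp (-x * t)) atTop (nhds 0) :=
      Real.tendsto_exp_atBot.comp (tendsto_id.const_mul_atTop_of_neg (neg_lt_zero.2 hx))
    refine squeeze_zero' ?_ ?_ h0
    · filter_upwards [eventually_ge_atTop 0] with t ht
      have h1 := hpos t
      have h2 := Real.sinh_nonneg_iff.2 ht
      positivity
    · filter_upwards [eventually_ge_atTop 0] with t ht
      have h2 := le_cosh_of_nonneg ht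
      have h3 : Real.sinh t / (1 + Real.cosh t) ≤ 1 := by
        rw [div_le_one (hpos t)]
        linarith [Real.sinh_lt_cosh t]
      calc _ ≤ Real.exp (-x * Real.cosh t) * 1 := by gcongr
        _ ≤ _ := by rw [mul_one, Real.exp_le_exp]; nlinarith
  have h := integral_Ioi_of_hasDerivAt_of_tendsto' (a := 0) (fun t _ ↦ hderiv t)
    (hint1.sub hint2) htend
  rw [integral_sub hint1 hint2, integral_const_mul] at h
  simpa [sub_eq_zero] using h

/-- The measure `exp (-x cosh t) dt` on `(0, ∞)` concentrates at `t = 0` as `x → ∞`: the integral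
of `cosh t - 1` against it is smaller than its mass `K₀ x` by a factor of order `1 / x`. -/
lemma integral_exp_neg_mul_cosh_mul_cosh_sub_one_le {x : ℝ} (hx : 0 < x) :
    ∫ t in Set.Ioi (0 : ℝ), Real.exp (-x * Real.cosh t) * (Real.cosh t - 1) ≤
      besselK 0 x / x := by
  rw [le_div_iff₀ hx, mul_comm, ← integral_exp_neg_mul_cosh_div hx, besselK_zero_eq]
  refine setIntegral_mono (integrableOn_exp_neg_mul_cosh_div hx)
    (integrableOn_exp_neg_mul_cosh hx) fun t ↦ ?_
  have := Real.cosh_pos t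
  refine mul_le_of_le_one_right (Real.exp_pos _).le ?_
  rw [div_le_one (by positivity)]
  linarith

/-! ### The tail integral -/

/-- The integral of `exp (-x cosh t) / (cosh t - ρ)` over `(0, ∞)`, which is the tail integral of
`exp (ρ y) K₀ y` up to an elementary factor. -/
noncomputable def besselTail (ρ x : ℝ) : ℝ :=
  ∫ t in Set.Ioi (0 : ℝ), Real.exp (-x * Real.cosh t) * (1 / (Real.cosh t - ρ))

lemma cosh_sub_pos {ρ : ℝ} (hρ : ρ < 1) (t : ℝ) : 0 < Real.cosh t - ρ := by
  linarith [Real.one_le_cosh t]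

lemma one_div_cosh_sub_le {ρ : ℝ} (hρ : ρ < 1) (t : ℝ) :
    1 / (Real.cosh t - ρ) ≤ 1 / (1 - ρ) :=
  one_div_le_one_div_of_le (sub_pos.2 hρ) (by linarith [Real.one_le_cosh t])

lemma integrableOn_besselTail {ρ x : ℝ} (hρ : ρ < 1) (hx : 0 < x) :
    IntegrableOn (fun t ↦ Real.exp (-x * Real.cosh t) * (1 / (Real.cosh t - ρ)))
      (Set.Ioi 0) := by
  refine integrableOn_exp_neg_mul_cosh_mul (b := 1 / (1 - ρ)) hx ?_ fun t ↦ ?_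
  · exact continuous_const.div (by fun_prop) fun t ↦ (cosh_sub_pos hρ t).ne'
  · rw [abs_of_pos (one_div_pos.2 (cosh_sub_pos hρ t))]
    exact one_div_cosh_sub_le hρ t

/-- Tonelli's theorem for the integral representation of `K₀`. -/
lemma lintegral_Ioi_exp_mul_besselK {a ρ x : ℝ} (ha : 0 < a) (hρ : ρ < 1) (hx : 0 < x) :
    ∫⁻ y in Set.Ioi x, ENNReal.ofReal (Real.exp (ρ * (a * y)) * besselK 0 (a * y)) =
      ENNReal.ofReal (Real.exp (ρ * (a * x)) / a * besselTail ρ (a * x)) := by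
  calc ∫⁻ y in Set.Ioi x, ENNReal.ofReal (Real.exp (ρ * (a * y)) * besselK 0 (a * y))
      = ∫⁻ y in Set.Ioi x, ∫⁻ t in Set.Ioi (0 : ℝ),
          ENNReal.ofReal (Real.exp (-(a * (Real.cosh t - ρ)) * y)) := by
        refine setLIntegral_congr_fun measurableSet_Ioi fun y (hy : x < y) ↦ ?_
        rw [ENNReal.ofReal_mul (Real.exp_pos _).le,
          ofReal_besselK_zero (mul_pos ha (hx.trans hy)), ← lintegral_const_mul _ (by fun_prop)]
        refine lintegral_congr fun t ↦ ?_
        rw [← ENNReal.ofReal_mul (Real.exp_pos _).le, ← Real.exp_add]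
        ring_nf
    _ = ∫⁻ t in Set.Ioi (0 : ℝ), ∫⁻ y in Set.Ioi x,
          ENNReal.ofReal (Real.exp (-(a * (Real.cosh t - ρ)) * y)) :=
        lintegral_lintegral_swap (by fun_prop)
    _ = ∫⁻ t in Set.Ioi (0 : ℝ), ENNReal.ofReal (Real.exp (ρ * (a * x)) / a *
          (Real.exp (-(a * x) * Real.cosh t) * (1 / (Real.cosh t - ρ)))) := by
        refine lintegral_congr fun t ↦ ?_
        have h := mul_pos ha (cosh_sub_pos hρ t)
        rw [← ofReal_integral_eq_lintegral_ofReal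
          (integrableOn_exp_mul_Ioi (neg_lt_zero.2 h) x)
          (Eventually.of_forall fun y ↦ (Real.exp_pos _).le),
          integral_exp_mul_Ioi (neg_lt_zero.2 h)]
        congr 1
        rw [neg_div_neg_eq, div_mul_eq_mul_div, ← mul_assoc, ← Real.exp_add, mul_one_div,
          div_div, mul_comm (Real.cosh t - ρ)]
        ring_nf
    _ = ENNReal.ofReal (Real.exp (ρ * (a * x)) / a * besselTail ρ (a * x)) := by
        rw [besselTail, ← integral_const_mul, ofReal_integral_eq_lintegral_ofReal
          ((integrableOn_besselTail hρ (mul_pos ha hx)).const_mul _)]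
        refine Eventually.of_forall fun t ↦ ?_
        have := cosh_sub_pos hρ t
        simp only [Pi.zero_apply]
        positivity

/-- The bound is strict because `cosh t > 1` for `t > 0`. -/
lemma besselTail_lt {ρ x : ℝ} (hρ : ρ < 1) (hx : 0 < x) :
    besselTail ρ x < besselK 0 x / (1 - ρ) := by
  rw [← mul_one_div, besselK_zero_eq, ← integral_mul_const, besselTail, ← sub_pos,
    ← integral_sub ((integrableOn_exp_neg_mul_cosh hx).mul_const _) (integrableOn_besselTail hρ hx)]
  rw [setIntegral_pos_iff_support_of_nonneg_ae]
  · refine lt_of_lt_of_le ?_ (measure_mono (s := Set.Ioi (0 : ℝ)) fun t ht ↦ ⟨?_, ht⟩)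
    · simp
    · have h1 := Real.one_lt_cosh.2 (ne_of_gt ht)
      have h2 : 1 / (Real.cosh t - ρ) < 1 / (1 - ρ) :=
        one_div_lt_one_div_of_lt (sub_pos.2 hρ) (by linarith)
      exact (sub_pos.2 (mul_lt_mul_of_pos_left h2 (Real.exp_pos _))).ne'
  · exact Eventually.of_forall fun t ↦ sub_nonneg.2
      (mul_le_mul_of_nonneg_left (one_div_cosh_sub_le hρ t) (Real.exp_pos _).le)
  · exact ((integrableOn_exp_neg_mul_cosh hx).mul_const _).sub (integrableOn_besselTail hρ hx)

/-- The lower bound matching `besselTail_lt`, with a relative error of order `1 / x`: the tangent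
line of `1 / (c - ρ)` at `c = 1` reduces it to the concentration estimate
`integral_exp_neg_mul_cosh_mul_cosh_sub_one_le`. -/
lemma le_besselTail {ρ x : ℝ} (hρ : ρ < 1) (hx : 0 < x) :
    besselK 0 x / (1 - ρ) * (1 - 1 / (1 - ρ) * (1 / x)) ≤ besselTail ρ x := by
  have h0 := sub_pos.2 hρ
  have h1 := integrableOn_exp_neg_mul_cosh hx
  have h2 := integrableOn_exp_neg_mul_cosh_mul_cosh_sub_one hx
  have h3 : (1 / (1 - ρ)) * besselK 0 x - (1 / (1 - ρ) ^ 2) *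
      ∫ t in Set.Ioi (0 : ℝ), Real.exp (-x * Real.cosh t) * (Real.cosh t - 1) ≤
        besselTail ρ x := by
    rw [besselK_zero_eq, ← integral_const_mul, ← integral_const_mul,
      ← integral_sub (h1.const_mul _) (h2.const_mul _), besselTail]
    refine setIntegral_mono ((h1.const_mul _).sub (h2.const_mul _))
      (integrableOn_besselTail hρ hx) fun t ↦ ?_
    -- the tangent line at `cosh t = 1` lies below the convex function `1 / (cosh t - ρ)`
    have h4 : 1 / (1 - ρ) - 1 / (1 - ρ) ^ 2 * (Real.cosh t - 1) ≤ 1 / (Real.cosh t - ρ) := by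
      have h5 := cosh_sub_pos hρ t
      rw [← sub_nonneg]
      have : 1 / (Real.cosh t - ρ) - (1 / (1 - ρ) - 1 / (1 - ρ) ^ 2 * (Real.cosh t - 1)) =
          (Real.cosh t - 1) ^ 2 / ((1 - ρ) ^ 2 * (Real.cosh t - ρ)) := by
        field_simp
        ring
      rw [this]
      positivity
    have := mul_le_mul_of_nonneg_left h4 (Real.exp_pos (-x * Real.cosh t)).le
    linarith
  refine le_trans ?_ h3
  have h6 := mul_le_mul_of_nonneg_left (integral_exp_neg_mul_cosh_mul_cosh_sub_one_le hx)
    (by positivity : 0 ≤ 1 / (1 - ρ) ^ 2)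
  have h7 : besselK 0 x / (1 - ρ) * (1 - 1 / (1 - ρ) * (1 / x)) =
      1 / (1 - ρ) * besselK 0 x - 1 / (1 - ρ) ^ 2 * (besselK 0 x / x) := by
    field_simp
  linarith

lemma tendsto_besselTail_div {ρ : ℝ} (hρ : ρ < 1) :
    Tendsto (fun x ↦ besselTail ρ x / (besselK 0 x / (1 - ρ))) atTop (nhds 1) := by
  have hl : Tendsto (fun x : ℝ ↦ 1 - 1 / (1 - ρ) * (1 / x)) atTop (nhds 1) := by
    have := (tendsto_const_nhds (x := 1 / (1 - ρ))).mul
      (tendsto_const_nhds (x := (1 : ℝ)).div_atTop tendsto_id)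
    simpa using (tendsto_const_nhds (x := (1 : ℝ))).sub this
  refine tendsto_of_tendsto_of_tendsto_of_le_of_le' hl tendsto_const_nhds ?_ ?_
  · filter_upwards [eventually_gt_atTop 0] with x hx
    rw [le_div_iff₀ (div_pos (besselK_zero_pos hx) (sub_pos.2 hρ)), mul_comm]
    exact le_besselTail hρ hx
  · filter_upwards [eventually_gt_atTop 0] with x hx
    rw [div_le_one (div_pos (besselK_zero_pos hx) (sub_pos.2 hρ))]
    exact (besselTail_lt hρ hx).le

/-! ### The density of the product -/

lemma lintegral_eq_two_mul_of_even {f : ℝ → ENNReal} (hf : ∀ x, f (-x) = f x) :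
    ∫⁻ x, f x = 2 * ∫⁻ x in Set.Ioi 0, f x := by
  have h : ∫⁻ x in Set.Iio 0, f x = ∫⁻ x in Set.Ioi 0, f x := by
    have := (Measure.measurePreserving_neg (volume : Measure ℝ)).setLIntegral_comp_preimage_emb
      (MeasurableEquiv.neg ℝ).measurableEmbedding f (Set.Ioi 0)
    simpa [hf] using this
  rw [← lintegral_add_compl f (measurableSet_Ioi (a := (0 : ℝ))), Set.compl_Ioi,
    ← setLIntegral_congr Iio_ae_eq_Iic, h, two_mul]

/-- The law of `X (W + c X)` for independent `X` and `W` with densities `p` and `q`. -/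
lemma map_mul_add_mul_prod_withDensity {p q : ℝ → ENNReal} (hp : Measurable p)
    (hq : Measurable q) (c : ℝ) :
    ((volume.withDensity p).prod (volume.withDensity q)).map
        (fun z : ℝ × ℝ ↦ z.1 * (z.2 + c * z.1)) =
      volume.withDensity
        (fun z ↦ ∫⁻ x, p x * (ENNReal.ofReal |x⁻¹| * q (x⁻¹ * z - c * x))) := by
  refine Measure.ext_of_lintegral _ fun f hf ↦ ?_
  have hinner (x : ℝ) (hx : x ≠ 0) : ∫⁻ w, q w * f (x * (w + c * x)) =
      ∫⁻ z, ENNReal.ofReal |x⁻¹| * q (x⁻¹ * z - c * x) * f z := by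
    have h1 := lintegral_add_right_eq_self (μ := (volume : Measure ℝ))
      (fun u ↦ q (u - c * x) * f (x * u)) (c * x)
    have h2 : ∫⁻ z, q (x⁻¹ * z - c * x) * f z ∂(Measure.map (fun u ↦ x * u) volume) =
        ∫⁻ u, q (u - c * x) * f (x * u) := by
      rw [lintegral_map (by fun_prop) (by fun_prop)]
      simp [inv_mul_cancel_left₀ hx]
    simp only [add_sub_cancel_right] at h1
    rw [h1, ← h2, Real.map_volume_mul_left hx, lintegral_smul_measure, smul_eq_mul,
      ← lintegral_const_mul _ (by fun_prop)]
    simp only [mul_assoc]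
  rw [lintegral_map hf (by fun_prop), prod_withDensity hp hq,
    lintegral_withDensity_eq_lintegral_mul _ (by fun_prop) (by fun_prop),
    lintegral_withDensity_eq_lintegral_mul _ ?_ hf]
  · simp only [Pi.mul_apply]
    rw [lintegral_prod _ (by fun_prop)]
    calc ∫⁻ x, ∫⁻ w, p x * q w * f (x * (w + c * x))
        = ∫⁻ x, ∫⁻ z, p x * (ENNReal.ofReal |x⁻¹| * q (x⁻¹ * z - c * x)) * f z := by
          refine lintegral_congr_ae ?_
          filter_upwards [Measure.ae_ne volume (0 : ℝ)] with x hx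
          simp only [mul_assoc]
          rw [lintegral_const_mul _ (by fun_prop), hinner x hx,
            ← lintegral_const_mul _ (by fun_prop)]
          simp only [mul_assoc]
      _ = ∫⁻ z, ∫⁻ x, p x * (ENNReal.ofReal |x⁻¹| * q (x⁻¹ * z - c * x)) * f z :=
          lintegral_lintegral_swap (by fun_prop)
      _ = _ := by
          refine lintegral_congr fun z ↦ ?_
          rw [lintegral_mul_const _ (by fun_prop)]
  · exact Measurable.lintegral_prod_right' (f := fun y : ℝ × ℝ ↦
      p y.2 * (ENNReal.ofReal |y.2⁻¹| * q (y.2⁻¹ * y.1 - c * y.2))) (by fun_prop)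

/-- The substitution `x = κ exp (u / 2)` on the half-line. -/
lemma lintegral_Ioi_eq_lintegral_exp_half {κ : ℝ} (hκ : 0 < κ) (g : ℝ → ENNReal) :
    ∫⁻ x in Set.Ioi 0, g x =
      ∫⁻ u, ENNReal.ofReal (κ * Real.exp (u / 2) / 2) * g (κ * Real.exp (u / 2)) := by
  have himg : (fun u : ℝ ↦ κ * Real.exp (u / 2)) '' Set.univ = Set.Ioi 0 := by
    ext x
    simp only [Set.image_univ, Set.mem_range, Set.mem_Ioi]
    constructor
    · rintro ⟨u, rfl⟩
      positivity
    · intro hx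
      refine ⟨2 * Real.log (x / κ), ?_⟩
      rw [mul_div_cancel_left₀ _ two_ne_zero, Real.exp_log (by positivity)]
      field_simp
  have hd (u : ℝ) : HasDerivAt (fun u : ℝ ↦ κ * Real.exp (u / 2))
      (κ * Real.exp (u / 2) / 2) u := by
    convert! ((hasDerivAt_id u).div_const 2).exp.const_mul κ using 1
    simp only [id]
    ring
  have hinj : Set.InjOn (fun u : ℝ ↦ κ * Real.exp (u / 2)) Set.univ := by
    intro u _ u' _ h
    have := Real.exp_injective (mul_left_cancel₀ hκ.ne' h)
    linarith
  rw [← himg, lintegral_image_eq_lintegral_abs_deriv_mul MeasurableSet.univ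
    (fun u _ ↦ (hd u).hasDerivWithinAt) hinj, Measure.restrict_univ]
  refine lintegral_congr fun u ↦ ?_
  rw [abs_of_pos (by positivity)]

/-- The integrand giving the density of the product at `z`, after the substitution
`x = κ exp (u / 2)` with `κ² = σX |z| / σY`, which turns the quadratic form in the exponent into a
multiple of `cosh u`. -/
lemma gaussianPDF_mul_gaussianPDF_exp_half {σX σY ρ z κ : ℝ} (hσX : 0 < σX) (hσY : 0 < σY)
    (hρ : ρ ^ 2 < 1) (hz : z ≠ 0) (hκ : 0 < κ) (hκ2 : κ ^ 2 = σX * |z| / σY) (u : ℝ) :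
    ENNReal.ofReal (κ * Real.exp (u / 2) / 2) *
      (gaussianPDF 0 (σX ^ 2).toNNReal (κ * Real.exp (u / 2)) *
        (ENNReal.ofReal |(κ * Real.exp (u / 2))⁻¹| *
          gaussianPDF 0 (σY ^ 2 * (1 - ρ ^ 2)).toNNReal
            ((κ * Real.exp (u / 2))⁻¹ * z - ρ * σY / σX * (κ * Real.exp (u / 2))))) =
    ENNReal.ofReal (1 / (4 * (Real.pi * (σX * σY) * Real.sqrt (1 - ρ ^ 2))) *
      Real.exp (ρ * z / (σX * σY * (1 - ρ ^ 2)))) *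
      ENNReal.ofReal (Real.exp (-(|z| / (σX * σY * (1 - ρ ^ 2))) * Real.cosh u)) := by
  have hr : 0 < 1 - ρ ^ 2 := sub_pos.2 hρ
  have hm : 0 < |z| := abs_pos.2 hz
  set x := κ * Real.exp (u / 2) with hxdef
  have hx : 0 < x := by positivity
  have hx2 : x ^ 2 = σX * |z| / σY * Real.exp u := by
    rw [hxdef, mul_pow, hκ2, ← Real.exp_nat_mul]
    congr 2
    push_cast
    ring
  have hnorm : Real.sqrt (2 * Real.pi * σX ^ 2) *
      Real.sqrt (2 * Real.pi * (σY ^ 2 * (1 - ρ ^ 2))) =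
      2 * (Real.pi * (σX * σY) * Real.sqrt (1 - ρ ^ 2)) := by
    rw [← Real.sqrt_mul (by positivity)]
    have : 2 * Real.pi * σX ^ 2 * (2 * Real.pi * (σY ^ 2 * (1 - ρ ^ 2))) =
      (2 * (Real.pi * (σX * σY))) ^ 2 * (1 - ρ ^ 2) := by ring
    rw [this, Real.sqrt_mul (by positivity), Real.sqrt_sq (by positivity)]
    ring
  have hexp : -(x - 0) ^ 2 / (2 * σX ^ 2) +
      -(x⁻¹ * z - ρ * σY / σX * x - 0) ^ 2 / (2 * (σY ^ 2 * (1 - ρ ^ 2))) =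
      ρ * z / (σX * σY * (1 - ρ ^ 2)) +
        -(|z| / (σX * σY * (1 - ρ ^ 2))) * Real.cosh u := by
    have h1 : (x⁻¹ * z - ρ * σY / σX * x - 0) ^ 2 =
        |z| ^ 2 / x ^ 2 - 2 * (ρ * σY / σX) * z + (ρ * σY / σX) ^ 2 * x ^ 2 := by
      rw [sq_abs]
      field_simp
      ring
    rw [h1, sub_zero, hx2, Real.cosh_eq, Real.exp_neg]
    have := Real.exp_pos u
    field_simp
    ring
  rw [gaussianPDF, gaussianPDF, ← ENNReal.ofReal_mul (abs_nonneg _),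
    ← ENNReal.ofReal_mul (gaussianPDFReal_nonneg _ _ _), ← ENNReal.ofReal_mul (by positivity),
    ← ENNReal.ofReal_mul (by positivity)]
  congr 1
  rw [gaussianPDFReal, gaussianPDFReal, Real.coe_toNNReal _ (by positivity),
    Real.coe_toNNReal _ (by positivity), abs_of_pos (by positivity), mul_assoc (1 / _),
    ← Real.exp_add, ← hexp, Real.exp_add]
  have h4 : 4 * (Real.pi * (σX * σY) * Real.sqrt (1 - ρ ^ 2)) =
      2 * (Real.sqrt (2 * Real.pi * σX ^ 2) *
        Real.sqrt (2 * Real.pi * (σY ^ 2 * (1 - ρ ^ 2)))) := by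
    rw [hnorm]
    ring
  have h5 : 0 < Real.sqrt (2 * Real.pi * σX ^ 2) := by positivity
  have h6 : 0 < Real.sqrt (2 * Real.pi * (σY ^ 2 * (1 - ρ ^ 2))) := by positivity
  rw [h4]
  generalize Real.sqrt (2 * Real.pi * σX ^ 2) = S at *
  generalize Real.sqrt (2 * Real.pi * (σY ^ 2 * (1 - ρ ^ 2))) = T at *
  generalize Real.exp (-(x - 0) ^ 2 / (2 * σX ^ 2)) = E at *
  generalize Real.exp (-(x⁻¹ * z - ρ * σY / σX * x - 0) ^ 2 / (2 * (σY ^ 2 * (1 - ρ ^ 2)))) = F at *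
  field_simp

lemma lintegral_gaussianPDF_mul_gaussianPDF {σX σY ρ z : ℝ} (hσX : 0 < σX) (hσY : 0 < σY)
    (hρ : ρ ^ 2 < 1) (hz : z ≠ 0) :
    ∫⁻ x, gaussianPDF 0 (σX ^ 2).toNNReal x * (ENNReal.ofReal |x⁻¹| *
        gaussianPDF 0 (σY ^ 2 * (1 - ρ ^ 2)).toNNReal (x⁻¹ * z - ρ * σY / σX * x)) =
      ENNReal.ofReal (productNormalPDF (σX * σY) ρ z) := by
  have hr : 0 < 1 - ρ ^ 2 := sub_pos.2 hρ
  have hm : 0 < |z| := abs_pos.2 hz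
  have heven (v : NNReal) (x : ℝ) : gaussianPDF 0 v (-x) = gaussianPDF 0 v x := by
    simp [gaussianPDF, gaussianPDFReal]
  have hκ : 0 < Real.sqrt (σX * |z| / σY) := by positivity
  have hκ2 : Real.sqrt (σX * |z| / σY) ^ 2 = σX * |z| / σY := Real.sq_sqrt (by positivity)
  rw [lintegral_eq_two_mul_of_even, lintegral_Ioi_eq_lintegral_exp_half hκ]
  · simp only [gaussianPDF_mul_gaussianPDF_exp_half hσX hσY hρ hz hκ hκ2]
    rw [lintegral_const_mul _ (by fun_prop),
      lintegral_eq_two_mul_of_even (fun u ↦ by rw [Real.cosh_neg]),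
      ← ofReal_besselK_zero (by positivity), productNormalPDF]
    have h2 : (2 : ENNReal) = ENNReal.ofReal 2 := by simp
    rw [h2, ← ENNReal.ofReal_mul (by positivity), ← ENNReal.ofReal_mul (by positivity),
      ← ENNReal.ofReal_mul (by positivity)]
    congr 1
    field_simp
    ring
  · intro x
    rw [heven, inv_neg, abs_neg]
    have : -x⁻¹ * z - ρ * σY / σX * -x = -(x⁻¹ * z - ρ * σY / σX * x) := by ring
    rw [this, heven]

/-- The regression residual `W = Y - (ρ σY / σX) X` is independent of `X`. -/
lemma IsCenteredBivariateNormal.map_residual {Ω : Type*} [MeasurableSpace Ω] {P : Measure Ω}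
    [IsProbabilityMeasure P] {X Y : Ω → ℝ} {σX σY ρ : ℝ} (hσX : 0 < σX)
    (h : IsCenteredBivariateNormal X Y P σX σY ρ) :
    P.map (fun ω ↦ (X ω, Y ω - ρ * σY / σX * X ω)) =
      (gaussianReal 0 (σX ^ 2).toNNReal).prod
        (gaussianReal 0 (σY ^ 2 * (1 - ρ ^ 2)).toNNReal) := by
  have hX := h.hasGaussianLaw.fst
  have hY := h.hasGaussianLaw.snd
  have hX2 := hX.memLp_two
  have hY2 := hY.memLp_two
  set c := ρ * σY / σX with hc
  have hcX2 : MemLp (fun ω ↦ c * X ω) 2 P := hX2.const_mul c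
  have hXW : HasGaussianLaw (fun ω ↦ (X ω, Y ω - c * X ω)) P :=
    h.hasGaussianLaw.map ((ContinuousLinearMap.fst ℝ ℝ ℝ).prod
      (ContinuousLinearMap.snd ℝ ℝ ℝ - c • ContinuousLinearMap.fst ℝ ℝ ℝ))
  have hvX : covariance X X P = σX ^ 2 := by
    rw [covariance_self hX.aemeasurable, h.variance_fst]
  have hcov : covariance X (fun ω ↦ Y ω - c * X ω) P = 0 := by
    rw [covariance_fun_sub_right hX2 hY2 hcX2, covariance_const_mul_right, hvX, h.covariance_eq, hc]
    field_simp
    ring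
  have hvar : variance (fun ω ↦ Y ω - c * X ω) P = σY ^ 2 * (1 - ρ ^ 2) := by
    have := variance_sub hY2 hcX2
    rw [show (fun ω ↦ Y ω - c * X ω) = Y - fun ω ↦ c * X ω from rfl, this,
      covariance_const_mul_right, covariance_comm, h.covariance_eq, variance_const_mul,
      h.variance_fst, h.variance_snd, hc]
    field_simp
    ring
  have hmean : ∫ ω, (Y ω - c * X ω) ∂P = 0 := by
    rw [integral_sub hY.integrable (hX.integrable.const_mul c), integral_const_mul, h.mean_fst,
      h.mean_snd]
    simp
  rw [(indepFun_iff_map_prod_eq_prod_map_map hX.aemeasurable hXW.snd.aemeasurable).1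
    (hXW.indepFun_of_covariance_eq_zero hcov), hX.map_eq_gaussianReal,
    hXW.snd.map_eq_gaussianReal, hvar, hmean, h.mean_fst, h.variance_fst]

/-- The density of the product of two correlated centered normal variables. It follows from
`X Y = X (W + c X)` with `W` the residual and `c = ρ σY / σX`. -/
theorem IsCenteredBivariateNormal.map_mul {Ω : Type*} [MeasurableSpace Ω] {P : Measure Ω}
    [IsProbabilityMeasure P] {X Y : Ω → ℝ} {σX σY ρ : ℝ} (hσX : 0 < σX) (hσY : 0 < σY)
    (hρ : ρ ^ 2 < 1) (h : IsCenteredBivariateNormal X Y P σX σY ρ) :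
    P.map (fun ω ↦ X ω * Y ω) =
      volume.withDensity (fun x ↦ ENNReal.ofReal (productNormalPDF (σX * σY) ρ x)) := by
  have hr : 0 < 1 - ρ ^ 2 := sub_pos.2 hρ
  have hX := h.hasGaussianLaw.fst.aemeasurable
  have hY := h.hasGaussianLaw.snd.aemeasurable
  have hmap : P.map (fun ω ↦ X ω * Y ω) =
      (P.map (fun ω ↦ (X ω, Y ω - ρ * σY / σX * X ω))).map
        (fun z : ℝ × ℝ ↦ z.1 * (z.2 + ρ * σY / σX * z.1)) := by
    rw [AEMeasurable.map_map_of_aemeasurable (by fun_prop) (by fun_prop)]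
    simp [Function.comp_def]
  rw [hmap, h.map_residual hσX,
    gaussianReal_of_var_ne_zero _ (Real.toNNReal_pos.2 (by positivity)).ne',
    gaussianReal_of_var_ne_zero _ (Real.toNNReal_pos.2 (by positivity)).ne',
    map_mul_add_mul_prod_withDensity (measurable_gaussianPDF _ _) (measurable_gaussianPDF _ _)]
  refine withDensity_congr_ae ?_
  filter_upwards [Measure.ae_ne volume (0 : ℝ)] with z hz
  exact lintegral_gaussianPDF_mul_gaussianPDF hσX hσY hρ hz

/-! ### The tail probability -/

lemma productNormalPDF_of_pos {s ρ x : ℝ} (hx : 0 < x) :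
    productNormalPDF s ρ x = 1 / (Real.pi * s * Real.sqrt (1 - ρ ^ 2)) *
      (Real.exp (ρ * (1 / (s * (1 - ρ ^ 2)) * x)) * besselK 0 (1 / (s * (1 - ρ ^ 2)) * x)) := by
  rw [productNormalPDF, abs_of_pos hx, mul_assoc]
  ring_nf

/-- The tail of the product as the claimed bound times a correction factor. The constants match
because `1 / a = s (1 + ρ) (1 - ρ)` for `a = 1 / (s (1 - ρ ^ 2))`. -/
theorem IsCenteredBivariateNormal.real_lt_mul {Ω : Type*} [MeasurableSpace Ω] {P : Measure Ω}
    [IsProbabilityMeasure P] {X Y : Ω → ℝ} {σX σY ρ x : ℝ} (hσX : 0 < σX) (hσY : 0 < σY)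
    (hρ0 : 0 ≤ ρ) (hρ1 : ρ < 1) (h : IsCenteredBivariateNormal X Y P σX σY ρ) (hx : 0 < x) :
    P.real {ω | x < X ω * Y ω} =
      σX * σY * (1 + ρ) * productNormalPDF (σX * σY) ρ x *
        (besselTail ρ (1 / (σX * σY * (1 - ρ ^ 2)) * x) /
          (besselK 0 (1 / (σX * σY * (1 - ρ ^ 2)) * x) / (1 - ρ))) := by
  have hρ : ρ ^ 2 < 1 := by nlinarith
  have hr : 0 < 1 - ρ ^ 2 := sub_pos.2 hρ
  have hX := h.hasGaussianLaw.fst.aemeasurable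
  have hY := h.hasGaussianLaw.snd.aemeasurable
  set a := 1 / (σX * σY * (1 - ρ ^ 2)) with hadef
  have ha : 0 < a := by positivity
  have hs : 0 < σX * σY := by positivity
  have hP : P {ω | x < X ω * Y ω} = P.map (fun ω ↦ X ω * Y ω) (Set.Ioi x) := by
    rw [Measure.map_apply_of_aemeasurable (by fun_prop) measurableSet_Ioi]
    rfl
  have hC : 0 ≤ 1 / (Real.pi * (σX * σY) * Real.sqrt (1 - ρ ^ 2)) := by positivity
  have hcongr : ∫⁻ y in Set.Ioi x, ENNReal.ofReal (productNormalPDF (σX * σY) ρ y) =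
      ∫⁻ y in Set.Ioi x, ENNReal.ofReal (1 / (Real.pi * (σX * σY) * Real.sqrt (1 - ρ ^ 2))) *
        ENNReal.ofReal (Real.exp (ρ * (a * y)) * besselK 0 (a * y)) := by
    refine setLIntegral_congr_fun measurableSet_Ioi fun y (hy : x < y) ↦ ?_
    rw [productNormalPDF_of_pos (hx.trans hy), ENNReal.ofReal_mul hC]
  have hT : 0 ≤ besselTail ρ (a * x) := by
    refine integral_nonneg fun t ↦ ?_
    have := cosh_sub_pos hρ1 t
    simp only [Pi.zero_apply]
    positivity
  have hK := besselK_zero_pos (mul_pos ha hx)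
  rw [Measure.real, hP, h.map_mul hσX hσY hρ, withDensity_apply _ measurableSet_Ioi, hcongr,
    lintegral_const_mul' _ _ ENNReal.ofReal_ne_top, lintegral_Ioi_exp_mul_besselK ha hρ1 hx,
    ← ENNReal.ofReal_mul hC, ENNReal.toReal_ofReal (by positivity), productNormalPDF_of_pos hx,
    ← hadef]
  have h1 : 1 / a = σX * σY * (1 + ρ) * (1 - ρ) := by
    rw [hadef, one_div_one_div]
    ring
  have h2 : 1 - ρ ≠ 0 := (sub_pos.2 hρ1).ne'
  rw [div_eq_mul_one_div (Real.exp _) a, h1]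
  generalize Real.sqrt (1 - ρ ^ 2) = S at *
  field_simp

lemma mul_productNormalPDF_eq {s ρ x : ℝ} (hs : 0 < s) (hρ0 : 0 ≤ ρ) (hρ1 : ρ < 1)
    (hx : 0 < x) :
    s * (1 + ρ) * productNormalPDF s ρ x =
      1 / Real.pi * Real.sqrt ((1 + ρ) / (1 - ρ)) * Real.exp (ρ * x / (s * (1 - ρ ^ 2))) *
        besselK 0 (x / (s * (1 - ρ ^ 2))) := by
  have h1 : 0 < 1 - ρ := sub_pos.2 hρ1
  have h2 : 0 < 1 + ρ := by linarith
  have h3 : Real.sqrt (1 - ρ ^ 2) = Real.sqrt (1 + ρ) * Real.sqrt (1 - ρ) := by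
    rw [← Real.sqrt_mul h2.le]
    ring_nf
  have h4 : Real.sqrt (1 + ρ) ≠ 0 := by positivity
  have h5 : Real.sqrt (1 - ρ) ≠ 0 := by positivity
  have h6 := Real.sq_sqrt h2.le
  rw [productNormalPDF, abs_of_pos hx, h3, Real.sqrt_div h2.le]
  generalize Real.exp (ρ * x / (s * (1 - ρ ^ 2))) = E at *
  generalize besselK 0 (x / (s * (1 - ρ ^ 2))) = K at *
  generalize Real.sqrt (1 + ρ) = A at *
  generalize Real.sqrt (1 - ρ) = B at *
  field_simp
  rw [h6]

lemma productNormalPDF_pos {s ρ x : ℝ} (hs : 0 < s) (hρ : ρ ^ 2 < 1) (hx : x ≠ 0) :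
    0 < productNormalPDF s ρ x := by
  have hr : 0 < 1 - ρ ^ 2 := sub_pos.2 hρ
  have hm : 0 < |x| := abs_pos.2 hx
  have := besselK_zero_pos (x := |x| / (s * (1 - ρ ^ 2))) (by positivity)
  rw [productNormalPDF]
  positivity

theorem mainTheorem9 {Ω : Type*} [MeasurableSpace Ω] (P : Measure Ω) [IsProbabilityMeasure P]
    (X Y : Ω → ℝ) (σX σY ρ s : ℝ) (hσX : 0 < σX) (hσY : 0 < σY) (hρ0 : 0 ≤ ρ) (hρ1 : ρ < 1)
    (hs : s = σX * σY) (hXY : IsCenteredBivariateNormal X Y P σX σY ρ) :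
    -- `f_Z` is the probability density function of `Z = XY`
    P.map (fun ω ↦ X ω * Y ω) =
        volume.withDensity (fun x ↦ ENNReal.ofReal (productNormalPDF s ρ x)) ∧
    -- the strict tail bound, and its explicit form
    (∀ x : ℝ, 0 < x →
      P.real {ω | x < X ω * Y ω} < s * (1 + ρ) * productNormalPDF s ρ x ∧
      s * (1 + ρ) * productNormalPDF s ρ x =
        1 / Real.pi * Real.sqrt ((1 + ρ) / (1 - ρ)) * Real.exp (ρ * x / (s * (1 - ρ ^ 2))) *
          besselK 0 (x / (s * (1 - ρ ^ 2)))) ∧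
    -- tightness: the tail and the bound are asymptotically equivalent
    (fun x : ℝ ↦ P.real {ω | x < X ω * Y ω}) ~[atTop]
      (fun x : ℝ ↦ s * (1 + ρ) * productNormalPDF s ρ x) := by
  subst hs
  have hρ : ρ ^ 2 < 1 := by nlinarith
  have hr : 0 < 1 - ρ ^ 2 := sub_pos.2 hρ
  have hs : 0 < σX * σY := by positivity
  have ha : 0 < 1 / (σX * σY * (1 - ρ ^ 2)) := by positivity
  refine ⟨hXY.map_mul hσX hσY hρ, fun x hx ↦ ⟨?_, mul_productNormalPDF_eq hs hρ0 hρ1 hx⟩, ?_⟩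
  · have hpos := productNormalPDF_pos hs hρ hx.ne'
    have hax := mul_pos ha hx
    rw [hXY.real_lt_mul hσX hσY hρ0 hρ1 hx]
    refine mul_lt_of_lt_one_right (by positivity) ?_
    rw [div_lt_one (div_pos (besselK_zero_pos hax) (sub_pos.2 hρ1))]
    exact besselTail_lt hρ1 hax
  · rw [isEquivalent_iff_exists_eq_mul]
    refine ⟨_, (tendsto_besselTail_div hρ1).comp (tendsto_id.const_mul_atTop ha), ?_⟩
    filter_upwards [eventually_gt_atTop 0] with x hx
    rw [hXY.real_lt_mul hσX hσY hρ0 hρ1 hx, Pi.mul_apply, mul_comm]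
    rfl
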